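/- Let $\log$ be the natural logarithm. In a dynamic graph problem with size parameter $n\ge 1$, a finite node set $V$ and a set $R$ of node pairs that may occur as edges are fixed. For **connectivity**, $V=[n]$ and $R=\binom{[n]}{2}$; for **bipartite perfect matching**, **bipartite maximum matching** and **bipartite minimum vertex cover**, $V=A\sqcup B$ with $|A|=|B|=n$ and $R=\{\{a,b\}:a\in A,\,b\in B\}$. A query asks, respectively, whether the current graph is connected (yes/no), whether it has a perfect matching (yes/no), for the size of a maximum matching, and for the size of a minimum vertex cover. An oblivious flip adversary fixes in advance an initial graph $H_0$ with edges in $R$ and node pairs $e_1,\dots,e_T\in R$. The $p$-smoothed dynamic graph $G_0,\dots,G_T$ is obtained as follows, with all random choices independent. Each node pair of $R$ is, with probability $p$, an edge of $G_0$ if and only if it is an edge of $H_0$, and otherwise (with probability $1-p$) it is re-sampled, becoming an edge with probability $1/2$. In round $i=1,\dots,T$ let $e_i'=e_i$ with probability $p$, and otherwise let $e_i'$ be drawn uniformly from $R$; then $E(G_i)=E(G_{i-1})\,\triangle\,\{e_i'\}$. An algorithm consists of three fixed word-RAM programs with unit-cost instructions, for preprocessing the initial graph, for processing a flip, and for answering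 a query. Words have $w$ bits, for any $w$ with $|V|<2^w$; flips are presented by the codes of the two nodes, and queries may be interleaved with the flips in any way. **Lemma.** For each of the four problems there are an algorithm and a constant $c$ such that: 1. the algorithm is trivial: it answers every query by "yes" for connectivity and bipartite perfect matching, and by the number $n$ for bipartite maximum matching and bipartite minimum vertex cover; 2. preprocessing, every update and every query take at most $c$ steps, for all $n$, all admissible $w$, all initial graphs and all sequences of operations; 3. for all $n\ge1$, all admissible $w$, all $p\in\left[0,\,1-\frac{26\log n}{n}\right)$, all integers $0\le T\le 2^{n/3}$ and every oblivious flip adversary $(H_0,e_1,\dots,e_T)$, with probability at least $1-\frac1n$ all queries in all rounds $0,1,\dots,T$ are answered correctly. -/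

import Mathlib

namespace SmoothedDynamic

/-! ### A word RAM with unit-cost instructions -/

/-- Instructions of a word RAM. Registers are numbered by natural numbers and hold `w`-bit words,
as do the memory cells, which are addressed by words. All arithmetic is modulo `2 ^ w`. -/
inductive Instr where
  /-- `reg d := k` -/
  | const (d k : ℕ)
  /-- `reg d := reg a` -/
  | move (d a : ℕ)
  | add (d a b : ℕ)
  | sub (d a b : ℕ)
  | mul (d a b : ℕ)
  | div (d a b : ℕ)
  | and (d a b : ℕ)
  | or (d a b : ℕ)
  | xor (d a b : ℕ)
  | shiftLeft (d a b : ℕ)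
  | shiftRight (d a b : ℕ)
  /-- `reg d := mem (reg a)` -/
  | load (d a : ℕ)
  /-- `mem (reg a) := reg b` -/
  | store (a b : ℕ)
  /-- `reg d := 1` if the input graph has an edge between the nodes with the codes
  `reg a` and `reg b`, and `reg d := 0` otherwise -/
  | edge (d a b : ℕ)
  /-- go to instruction `t` if `reg a = 0` -/
  | jumpZero (a t : ℕ)
  /-- go to instruction `t` if `reg a < reg b` -/
  | jumpLess (a b t : ℕ)

/-- A configuration of the machine: program counter, registers and memory. -/
structure State (w : ℕ) where
  pc : ℕ
  reg : ℕ → BitVec w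
  mem : BitVec w → BitVec w

namespace State

variable {w : ℕ}

/-- Write the word `x` to register `d` and go on to the next instruction. -/
def write (s : State w) (d : ℕ) (x : BitVec w) : State w :=
  { s with pc := s.pc + 1, reg := Function.update s.reg d x }

/-- Conditional jump. -/
def jumpIf (s : State w) (b : Bool) (t : ℕ) : State w :=
  { s with pc := if b then t else s.pc + 1 }

/-- Prepare the start of a procedure without arguments: registers and memory persist. -/
def start (s : State w) : State w := { s with pc := 0 }

/-- Prepare the start of a procedure with two arguments, passed in registers `0` and `1`. -/
def startWith (s : State w) (x y : BitVec w) : State w :=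
  { s with pc := 0, reg := Function.update (Function.update s.reg 0 x) 1 y }

end State

/-- The effect of a single instruction; `input` gives the adjacency of the input graph. -/
def Instr.apply {w : ℕ} (input : BitVec w → BitVec w → Bool) (s : State w) : Instr → State w
  | const d k => s.write d (BitVec.ofNat w k)
  | move d a => s.write d (s.reg a)
  | add d a b => s.write d (s.reg a + s.reg b)
  | sub d a b => s.write d (s.reg a - s.reg b)
  | mul d a b => s.write d (s.reg a * s.reg b)
  | div d a b => s.write d (s.reg a / s.reg b)
  | and d a b => s.write d (s.reg a &&& s.reg b)
  | or d a b => s.write d (s.reg a ||| s.reg b)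
  | xor d a b => s.write d (s.reg a ^^^ s.reg b)
  | shiftLeft d a b => s.write d (s.reg a <<< s.reg b)
  | shiftRight d a b => s.write d (s.reg a >>> s.reg b)
  | load d a => s.write d (s.mem (s.reg a))
  | store a b => { s with pc := s.pc + 1, mem := Function.update s.mem (s.reg a) (s.reg b) }
  | edge d a b => s.write d (if input (s.reg a) (s.reg b) then 1 else 0)
  | jumpZero a t => s.jumpIf (s.reg a == 0) t
  | jumpLess a b t => s.jumpIf ((s.reg a).toNat < (s.reg b).toNat) t

/-- A program is a finite list of instructions; it halts when the program counter leaves it. -/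
abbrev Program := List Instr

/-- One step of a program, at unit cost. -/
def step {w : ℕ} (P : Program) (input : BitVec w → BitVec w → Bool) (s : State w) : State w :=
  match P[s.pc]? with
  | none => s
  | some i => i.apply input s

open Classical in
/-- The running time of a program started in configuration `s`, with the final configuration;
`none` if the program does not halt. -/
noncomputable def exec {w : ℕ} (P : Program) (input : BitVec w → BitVec w → Bool) (s : State w) :
    Option (ℕ × State w) :=
  if h : ∃ t : ℕ, P.length ≤ ((step P input)^[t] s).pc then
    some (Nat.find h, (step P input)^[Nat.find h] s)
  else none

/-- The program halts after at most `c` steps. -/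
def HaltsWithin {w : ℕ} (P : Program) (input : BitVec w → BitVec w → Bool) (s : State w) (c : ℕ) :
    Prop :=
  ∃ r, exec P input s = some r ∧ r.1 ≤ c

/-! ### Dynamic graphs and dynamic graph problems -/

/-- Flip the node pair `e` of the graph `G`. -/
def flipEdge {V : Type} (G : SimpleGraph V) (e : Sym2 V) : SimpleGraph V :=
  SimpleGraph.fromEdgeSet (symmDiff G.edgeSet {e})

/-- Flip the node pairs of a list one after another. -/
def flipEdges {V : Type} (G : SimpleGraph V) (l : List (Sym2 V)) : SimpleGraph V :=
  l.foldl flipEdge G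

/-- A dynamic graph problem, for every size parameter `n`: a finite node set, with the codes of the
nodes by which they are presented to an algorithm; the graph of all node pairs that may occur as
edges; and the relation that tells which numbers are correct answers to a query on a graph. -/
structure DynProblem where
  V : ℕ → Type
  fintypeV : ∀ n, Fintype (V n)
  numNodes : ℕ → ℕ
  code : ∀ n, V n ≃ Fin (numNodes n)
  allowed : ∀ n, SimpleGraph (V n)
  IsAnswer : ∀ n, SimpleGraph (V n) → ℕ → Prop

attribute [instance] DynProblem.fintypeV

/-- The correct answer to a decision problem: `1` for yes and `0` for no. -/
def IsYesNo (Q : Prop) (a : ℕ) : Prop := (Q ∧ a = 1) ∨ (¬ Q ∧ a = 0)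

/-- Graphs on `n` nodes; the query asks whether the graph is connected. -/
def connectivity : DynProblem where
  V n := Fin n
  fintypeV _ := inferInstance
  numNodes n := n
  code n := Equiv.refl (Fin n)
  allowed _ := ⊤
  IsAnswer _ G a := IsYesNo G.Connected a

/-- Dynamic problems on bipartite graphs with `n` nodes on each side. -/
def bipartiteProblem (IsAnswer : ∀ n : ℕ, SimpleGraph (Fin n ⊕ Fin n) → ℕ → Prop) :
    DynProblem where
  V n := Fin n ⊕ Fin n
  fintypeV _ := inferInstance
  numNodes n := n + n
  code _ := finSumFinEquiv
  allowed n := completeBipartiteGraph (Fin n) (Fin n)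
  IsAnswer := IsAnswer

/-- The query asks whether the graph has a perfect matching. -/
def bipartitePerfectMatching : DynProblem :=
  bipartiteProblem fun _ G a => IsYesNo (∃ M : G.Subgraph, M.IsPerfectMatching) a

/-- The query asks for the size of a maximum matching. -/
def bipartiteMaximumMatching : DynProblem :=
  bipartiteProblem fun _ G a =>
    IsGreatest {m : ℕ | ∃ M : G.Subgraph, M.IsMatching ∧ M.edgeSet.ncard = m} a

/-- The query asks for the size of a minimum vertex cover. -/
def bipartiteMinimumVertexCover : DynProblem :=
  bipartiteProblem fun _ G a => G.vertexCoverNum = (a : ℕ∞)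

/-! ### Dynamic graph algorithms -/

/-- An operation on a dynamic graph: flip the node pair `{u, v}`, or query the current graph. -/
inductive Op (V : Type) where
  | flip (u v : V)
  | query

/-- The node pair flipped by an operation, if any. -/
def Op.pair? {V : Type} : Op V → Option (Sym2 V)
  | flip u v => some s(u, v)
  | query => none

/-- The node pairs that are flipped in a sequence of operations, in order. -/
def flipsOf {V : Type} (h : List (Op V)) : List (Sym2 V) := h.filterMap Op.pair?

/-- A dynamic graph algorithm: three fixed programs, for preprocessing the initial graph,
for processing an edge change and for answering a query. -/
structure DynAlg where
  pre : Program
  upd : Program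
  qry : Program

/-- Outside of preprocessing there is no input graph to be read. -/
def noInput {w : ℕ} : BitVec w → BitVec w → Bool := fun _ _ => false

namespace DynAlg

variable (A : DynAlg) (Q : DynProblem) (n w : ℕ)

open Classical in
/-- The adjacency of the initial graph, in terms of the codes of the nodes. -/
noncomputable def inputOf (G₀ : SimpleGraph (Q.V n)) (x y : BitVec w) : Bool :=
  decide (∃ u v, (Q.code n u : ℕ) = x.toNat ∧ (Q.code n v : ℕ) = y.toNat ∧ G₀.Adj u v)

/-- The machine before preprocessing: register `0` holds `n`, everything else is zero. -/
def blank : State w := ⟨0, Function.update (fun _ => 0) 0 (BitVec.ofNat w n), fun _ => 0⟩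

/-- Start of the update procedure: registers `0` and `1` hold the codes of the two nodes. -/
def startUpdate (s : State w) (u v : Q.V n) : State w :=
  s.startWith (BitVec.ofNat w (Q.code n u)) (BitVec.ofNat w (Q.code n v))

/-- Execute one operation. -/
noncomputable def process (s : State w) : Op (Q.V n) → Option (State w)
  | .flip u v => (exec A.upd noInput (startUpdate Q n w s u v)).map Prod.snd
  | .query => (exec A.qry noInput s.start).map Prod.snd

/-- The configuration after preprocessing `G₀` and executing a sequence of operations;
`none` if some procedure does not halt. -/
noncomputable def stateAfter (G₀ : SimpleGraph (Q.V n)) (h : List (Op (Q.V n))) :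
    Option (State w) :=
  (exec A.pre (inputOf Q n w G₀) (blank n w)).bind fun r => h.foldlM (A.process Q n w) r.2

/-- The answer, given in register `0`, to a query that follows a sequence of operations. -/
noncomputable def answer (G₀ : SimpleGraph (Q.V n)) (h : List (Op (Q.V n))) : Option (BitVec w) :=
  (A.stateAfter Q n w G₀ h).bind fun s =>
    (exec A.qry noInput s.start).map fun r => r.2.reg 0

variable {n}

/-- Every query on the initial graph `G₀` and on the graphs obtained from it by successively
flipping the node pairs of the list `l` is answered, and correctly, however queries are interleaved
with the flips. -/
def CorrectInAllRounds (G₀ : SimpleGraph (Q.V n)) (l : List (Sym2 (Q.V n))) : Prop :=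
  ∀ h : List (Op (Q.V n)), flipsOf h <+: l →
    ∃ a, A.answer Q n w G₀ h = some a ∧ Q.IsAnswer n (flipEdges G₀ (flipsOf h)) a.toNat

variable {w}

/-- Preprocessing, each update and each query halt after at most `c` steps, for all `n`, all
initial graphs and all sequences of operations, on words that can hold the number of nodes. -/
def RunsInTime (c : ℕ) : Prop :=
  ∀ n w : ℕ, Q.numNodes n < 2 ^ w → ∀ G₀ ≤ Q.allowed n,
    HaltsWithin A.pre (inputOf Q n w G₀) (blank n w) c ∧
    ∀ (h : List (Op (Q.V n))) (s : State w), A.stateAfter Q n w G₀ h = some s →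
      (∀ u v, (Q.allowed n).Adj u v → HaltsWithin A.upd noInput (startUpdate Q n w s u v) c) ∧
      HaltsWithin A.qry noInput s.start c

/-- All queries for size parameter `n` are answered by the number `a n`, whatever the graph. -/
def AlwaysAnswers (a : ℕ → ℕ) : Prop :=
  ∀ n w : ℕ, Q.numNodes n < 2 ^ w → ∀ G₀ ≤ Q.allowed n, ∀ h : List (Op (Q.V n)),
    A.answer Q n w G₀ h = some (BitVec.ofNat w (a n))

end DynAlg

/-! ### Smoothed dynamic graphs with an oblivious flip adversary -/

/-- The law of a biased coin that shows `true` with probability `p`. -/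
noncomputable def coin (p : unitInterval) : PMF Bool :=
  PMF.ofFintype
    (fun b => if b then ENNReal.ofReal (p : ℝ) else ENNReal.ofReal (1 - (p : ℝ))) (by
      rw [Fintype.sum_bool, if_pos rfl, if_neg Bool.false_ne_true,
        ← ENNReal.ofReal_add p.2.1 (sub_nonneg.2 p.2.2)]
      simp)

/-- With probability `p` keep `x`, and otherwise re-sample uniformly. -/
noncomputable def smooth {α : Type} [Fintype α] (p : unitInterval) (x : α) : PMF α :=
  haveI : Nonempty α := ⟨x⟩
  (coin p).bind fun c => if c then PMF.pure x else PMF.uniformOfFintype α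

open Classical in
/-- The joint law of finitely many independent random variables with given laws. -/
noncomputable def independent {ι α : Type} [Fintype ι] [Fintype α] (f : ι → PMF α) :
    PMF (ι → α) :=
  PMF.ofFintype (fun x => ∏ i, f i (x i)) (by
    have key := Finset.prod_univ_sum (fun _ : ι => (Finset.univ : Finset α)) fun i a => f i a
    rw [Fintype.piFinset_univ] at key
    rw [← key]
    refine Finset.prod_eq_one fun i _ => ?_
    have h := (f i).tsum_coe
    rwa [tsum_fintype] at h)

/-- The graph with edges in `R` whose edges are marked by `b`. -/
def graphOf {V : Type} {R : SimpleGraph V} (b : R.edgeSet → Bool) : SimpleGraph V :=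
  SimpleGraph.fromEdgeSet {d | ∃ hd : d ∈ R.edgeSet, b ⟨d, hd⟩ = true}

open Classical in
/-- The law of a `p`-smoothed dynamic graph with `T` changes, on the node pairs in `R`, for the
oblivious flip adversary that proposes the initial graph `H₀` and the node pairs `e`: the law of the
initial graph and the sequence of the node pairs that are flipped. Each node pair of the initial
graph and each change is kept with probability `p` and otherwise re-sampled uniformly, all of them
independently. -/
noncomputable def smoothedLaw {V : Type} [Fintype V] {T : ℕ} (p : unitInterval)
    (R H₀ : SimpleGraph V) (e : Fin T → R.edgeSet) : PMF (SimpleGraph V × List (Sym2 V)) :=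
  (independent fun d : R.edgeSet => smooth p (decide ((d : Sym2 V) ∈ H₀.edgeSet))).bind fun b =>
    (independent fun i : Fin T => smooth p (e i)).map fun f =>
      (graphOf b, List.ofFn fun i => (f i : Sym2 V))

end SmoothedDynamic

/-!
The trivial algorithm stores its constant answer once and for all during preprocessing and ignores
all updates. It remains to see that with probability at least `1 - 1 / n` the graph is connected, or
has a perfect matching, in all rounds. A perfect matching settles all three bipartite problems: it
has `n` edges, and every vertex cover needs a node of its own for each of them.

Write `q = 1 - p` and let `N` be the number of node pairs in `R`. A graph without the property
avoids all node pairs of some obstruction `F`: the pairs across a cut, or, by Hall's theorem, the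
pairs between two sets with `n + 1` nodes in total on the two sides of the bipartition. The
probability that `F` is avoided after `t` changes is bounded by Fourier analysis. Give a node pair
the sign `-1` if it is an edge and `1` otherwise. The indicator of avoiding `F` is the product of
`(1 + sign) / 2` over `F`, hence `2 ^ (-|F|)` times the sum over `S ⊆ F` of the characters `∏ d ∈ S,
sign d`. The sign of `d` after `t` changes is its initial sign times one factor `-1` for each flip
of `d`, so the expectation of a character factors over the independent choices. In absolute value
every pair in `S` contributes `p` through the initial graph, and every change at most `p + q |1 - 2
|S| / N| ≤ exp (-q |S| / N)`, as long as `|S| ≤ 2 N / 3` (`abs_sum_weight_mul_prod_edgeSign_le`).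
Summing over `S`, the probability is at most `((1 + r) / 2) ^ |F|` with `r = p * exp (-q t / N)`
(`sum_weight_mul_prod_nonedge_le`).

It remains to take a union bound over rounds and obstructions (`HasObstructions.le_smoothedLaw`).
In the first `n ^ 3` rounds `r ≤ p` is used: as `q n > 26 log n`, each of them fails with
probability `O (n ^ (-5))`. Later on the initial bias is washed out, `r ≤ 1 / n`, and a round
fails with probability `O (n * 2 ^ (-n / 2))`, which beats the number `2 ^ (n / 3)` of rounds. Here
`n` may be assumed to be large, since `26 log n < n` rules out `2 ≤ n < 108` and the claim is void
for `n = 1`.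
-/

namespace SmoothedDynamic

/-! ### The trivial algorithm -/

section Algorithm

variable {w : ℕ}

theorem exec_nil (input : BitVec w → BitVec w → Bool) (s : State w) :
    exec [] input s = some (0, s) := by
  have h : ∃ t : ℕ, ([] : Program).length ≤ ((step [] input)^[t] s).pc := ⟨0, Nat.zero_le _⟩
  have h0 : Nat.find h = 0 := (Nat.find_eq_zero h).2 (Nat.zero_le _)
  rw [exec, dif_pos h, h0]
  rfl

theorem exec_singleton (input : BitVec w → BitVec w → Bool) (i : Instr) (s : State w)
    (hs : s.pc = 0) (hi : (i.apply input s).pc = 1) :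
    exec [i] input s = some (1, i.apply input s) := by
  have hstep : step [i] input s = i.apply input s := by simp [step, hs]
  have h : ∃ t : ℕ, [i].length ≤ ((step [i] input)^[t] s).pc := ⟨1, by simp [hstep, hi]⟩
  have h1 : Nat.find h = 1 := by
    rw [Nat.find_eq_iff]
    refine ⟨by simp [hstep, hi], fun k hk => ?_⟩
    obtain rfl : k = 0 := by omega
    simp [hs]
  rw [exec, dif_pos h, h1, Function.iterate_one, hstep]

/-- The algorithm that executes the single instruction `i` for preprocessing, ignores all updates
and answers every query by the content of register `2`. -/
def constAlg (i : Instr) : DynAlg := ⟨[i], [], [.move 0 2]⟩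

/-- The instruction `i` leaves the number `a n` in register `2`, whatever the input graph. -/
def Presets (i : Instr) (a : ℕ → ℕ) : Prop :=
  ∀ (n w : ℕ) (input : BitVec w → BitVec w → Bool),
    (i.apply input (DynAlg.blank n w)).pc = 1 ∧
      (i.apply input (DynAlg.blank n w)).reg 2 = BitVec.ofNat w (a n)

theorem presets_const (k : ℕ) : Presets (.const 2 k) fun _ => k := fun n w input => by
  simp [Instr.apply, State.write, DynAlg.blank]

theorem presets_move : Presets (.move 2 0) fun n => n := fun n w input => by
  simp [Instr.apply, State.write, DynAlg.blank]

theorem exec_query (input : BitVec w → BitVec w → Bool) (s : State w) :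
    exec [.move 0 2] input s.start = some (1, s.start.write 0 (s.reg 2)) :=
  exec_singleton _ _ _ rfl rfl

/-- Register `2` is never overwritten after preprocessing. -/
theorem exists_foldlM_constAlg (i : Instr) (Q : DynProblem) (n : ℕ) (h : List (Op (Q.V n)))
    (s : State w) :
    ∃ s', h.foldlM ((constAlg i).process Q n w) s = some s' ∧ s'.reg 2 = s.reg 2 := by
  induction h generalizing s with
  | nil => exact ⟨s, rfl, rfl⟩
  | cons o h ih =>
    obtain ⟨s₁, h₁, h₁'⟩ : ∃ s₁, (constAlg i).process Q n w s o = some s₁ ∧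
        s₁.reg 2 = s.reg 2 := by
      cases o with
      | flip u v =>
        refine ⟨DynAlg.startUpdate Q n w s u v, ?_, ?_⟩
        · simp [DynAlg.process, constAlg, exec_nil]
        · simp [DynAlg.startUpdate, State.startWith]
      | query =>
        refine ⟨s.start.write 0 (s.reg 2), ?_, ?_⟩
        · simp [DynAlg.process, constAlg, exec_query]
        · simp [State.write, State.start]
    obtain ⟨s₂, h₂, h₂'⟩ := ih s₁
    exact ⟨s₂, by simp [List.foldlM_cons, h₁, h₂], h₂'.trans h₁'⟩

theorem answer_constAlg {i : Instr} {a : ℕ → ℕ} (hi : Presets i a) (Q : DynProblem) (n w : ℕ)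
    (G₀ : SimpleGraph (Q.V n)) (h : List (Op (Q.V n))) :
    (constAlg i).answer Q n w G₀ h = some (BitVec.ofNat w (a n)) := by
  obtain ⟨hpc, hreg⟩ := hi n w (DynAlg.inputOf Q n w G₀)
  have hpre : exec (constAlg i).pre (DynAlg.inputOf Q n w G₀) (DynAlg.blank n w) = _ :=
    exec_singleton _ _ _ rfl hpc
  obtain ⟨s, hs, hs'⟩ := exists_foldlM_constAlg i Q n h
    (i.apply (DynAlg.inputOf Q n w G₀) (DynAlg.blank n w))
  have hq : exec (constAlg i).qry noInput s.start = _ := exec_query noInput s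
  simp [DynAlg.answer, DynAlg.stateAfter, hpre, hs, hq, State.write, hs', hreg]

theorem runsInTime_constAlg {i : Instr} {a : ℕ → ℕ} (hi : Presets i a) (Q : DynProblem) :
    (constAlg i).RunsInTime Q 1 := fun n w _ _ _ =>
  ⟨⟨_, exec_singleton _ _ _ rfl (hi n w _).1, le_rfl⟩, fun _ s _ =>
    ⟨fun _ _ _ => ⟨_, exec_nil _ _, Nat.zero_le _⟩, ⟨_, exec_query _ s, le_rfl⟩⟩⟩

/-- The constant answer `a n` is correct in all rounds as soon as it is correct for every graph
that occurs. -/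
theorem correctInAllRounds_constAlg {i : Instr} {a : ℕ → ℕ} (hi : Presets i a) (Q : DynProblem)
    {n w : ℕ} (hw : a n < 2 ^ w) (G₀ : SimpleGraph (Q.V n)) (l : List (Sym2 (Q.V n)))
    (hl : ∀ t ≤ l.length, Q.IsAnswer n (flipEdges G₀ (l.take t)) (a n)) :
    (constAlg i).CorrectInAllRounds Q w G₀ l := fun h hh => by
  refine ⟨_, answer_constAlg hi Q n w G₀ h, ?_⟩
  rw [BitVec.toNat_ofNat, Nat.mod_eq_of_lt hw, List.prefix_iff_eq_take.1 hh]
  exact hl _ hh.length_le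

end Algorithm

/-! ### Signs of node pairs along a sequence of flips -/

section Signs

variable {V : Type}

open Classical in
/-- The sign of the node pair `d` in the graph `G`: `-1` for an edge and `1` for a non-edge. -/
noncomputable def edgeSign (G : SimpleGraph V) (d : Sym2 V) : ℝ := if d ∈ G.edgeSet then -1 else 1

open Classical in
theorem edgeSign_flipEdge (G : SimpleGraph V) (e d : Sym2 V) (hd : ¬ d.IsDiag) :
    edgeSign (flipEdge G e) d = edgeSign G d * if e = d then -1 else 1 := by
  have h : d ∈ (flipEdge G e).edgeSet ↔ (d ∈ G.edgeSet ∧ e ≠ d ∨ e = d ∧ d ∉ G.edgeSet) := by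
    simp only [flipEdge, SimpleGraph.edgeSet_fromEdgeSet, Set.mem_sdiff, Set.mem_symmDiff,
      Set.mem_singleton_iff]
    constructor
    · rintro ⟨h | h, -⟩
      · exact Or.inl ⟨h.1, fun he => h.2 he.symm⟩
      · exact Or.inr ⟨h.1.symm, h.2⟩
    · rintro (h | h)
      · exact ⟨Or.inl ⟨h.1, fun he => h.2 he.symm⟩, hd⟩
      · exact ⟨Or.inr ⟨h.1.symm, h.2⟩, hd⟩
  unfold edgeSign
  simp only [h]
  by_cases h1 : d ∈ G.edgeSet <;> by_cases h2 : e = d <;> simp [h1, h2]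

open Classical in
theorem edgeSign_flipEdges (G : SimpleGraph V) (l : List (Sym2 V)) (d : Sym2 V) (hd : ¬ d.IsDiag) :
    edgeSign (flipEdges G l) d = edgeSign G d * (l.map fun e => if e = d then -1 else 1).prod := by
  induction l generalizing G with
  | nil => simp [flipEdges]
  | cons e l ih =>
    have := ih (flipEdge G e)
    rw [edgeSign_flipEdge G e d hd] at this
    simpa [flipEdges, mul_assoc] using this

theorem flipEdges_le {R : SimpleGraph V} (G : SimpleGraph V) (l : List (Sym2 V)) (hG : G ≤ R)
    (hl : ∀ e ∈ l, e ∈ R.edgeSet) : flipEdges G l ≤ R := by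
  induction l generalizing G with
  | nil => simpa [flipEdges] using hG
  | cons e l ih =>
    refine ih (flipEdge G e) ?_ fun e' he' => hl e' (List.mem_cons_of_mem _ he')
    rw [← SimpleGraph.edgeSet_subset_edgeSet] at hG ⊢
    intro d hd
    simp only [flipEdge, SimpleGraph.edgeSet_fromEdgeSet, Set.mem_sdiff, Set.mem_symmDiff,
      Set.mem_singleton_iff] at hd
    rcases hd.1 with h | h
    · exact hG h.1
    · exact h.1 ▸ hl e (by simp)

theorem graphOf_le {R : SimpleGraph V} (b : R.edgeSet → Bool) : graphOf b ≤ R := by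
  rw [← SimpleGraph.edgeSet_subset_edgeSet, graphOf, SimpleGraph.edgeSet_fromEdgeSet]
  rintro d ⟨⟨hd, -⟩, -⟩
  exact hd

theorem edgeSign_graphOf {R : SimpleGraph V} (b : R.edgeSet → Bool) (d : R.edgeSet) :
    edgeSign (graphOf b) d = if b d then -1 else 1 := by
  have h : (d : Sym2 V) ∈ (graphOf b).edgeSet ↔ b d = true := by
    rw [graphOf, SimpleGraph.edgeSet_fromEdgeSet]
    exact ⟨fun h => h.1.2, fun h => ⟨⟨d.2, h⟩, R.not_isDiag_of_mem_edgeSet d.2⟩⟩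
  simp [edgeSign, h]

open Classical in
theorem edgeSign_round {R : SimpleGraph V} {T : ℕ} (b : R.edgeSet → Bool) (f : Fin T → R.edgeSet)
    (t : ℕ) (d : R.edgeSet) :
    edgeSign (flipEdges (graphOf b) ((List.ofFn fun i => (f i : Sym2 V)).take t)) d =
      (if b d then -1 else 1) * ∏ i : Fin T, if (i : ℕ) < t ∧ f i = d then (-1 : ℝ) else 1 := by
  rw [edgeSign_flipEdges _ _ _ (R.not_isDiag_of_mem_edgeSet d.2), edgeSign_graphOf, List.map_take,
    List.map_ofFn, List.prod_take_ofFn, Finset.prod_filter]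
  congr 1
  refine Finset.prod_congr rfl fun i _ => ?_
  by_cases h : (i : ℕ) < t <;> simp [h, Subtype.ext_iff]

end Signs

/-! ### Expectations over the smoothed law -/

section Expectation

variable {α : Type} [Fintype α]

theorem coin_toReal (p : unitInterval) (c : Bool) :
    (coin p c).toReal = if c then (p : ℝ) else 1 - p := by
  cases c
  · simp [coin, ENNReal.toReal_ofReal (sub_nonneg.2 p.2.2)]
  · simp [coin, ENNReal.toReal_ofReal p.2.1]

open Classical in
theorem smooth_toReal (p : unitInterval) (x y : α) :
    (smooth p x y).toReal = (if y = x then (p : ℝ) else 0) + (1 - p) / Fintype.card α := by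
  have hne : Nonempty α := ⟨x⟩
  rw [smooth, PMF.bind_apply, tsum_bool, ENNReal.toReal_add, ENNReal.toReal_mul,
    ENNReal.toReal_mul, coin_toReal, coin_toReal, add_comm]
  · congr 1
    · by_cases h : y = x <;> simp [h]
    · simp [div_eq_mul_inv]
  · exact ENNReal.mul_ne_top (PMF.apply_ne_top _ _) (PMF.apply_ne_top _ _)
  · exact ENNReal.mul_ne_top (PMF.apply_ne_top _ _) (PMF.apply_ne_top _ _)

theorem sum_smooth_mul (p : unitInterval) (x : α) (g : α → ℝ) :
    ∑ y, (smooth p x y).toReal * g y = p * g x + (1 - p) / Fintype.card α * ∑ y, g y := by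
  classical
  simp [smooth_toReal, add_mul, Finset.sum_add_distrib, Finset.mul_sum]

theorem sum_toReal_eq_one (q : PMF α) : ∑ x, (q x).toReal = 1 := by
  rw [← ENNReal.toReal_sum fun x _ => q.apply_ne_top x,
    ← tsum_fintype (L := .unconditional _), q.tsum_coe, ENNReal.toReal_one]

theorem sum_independent_mul_prod {ι : Type} [Fintype ι] [DecidableEq ι] (q : ι → PMF α)
    (g : ι → α → ℝ) :
    ∑ x : ι → α, (independent q x).toReal * ∏ i, g i (x i) =
      ∏ i, ∑ a, (q i a).toReal * g i a := by
  rw [Finset.prod_univ_sum, Fintype.piFinset_univ]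
  refine Finset.sum_congr rfl fun x _ => ?_
  rw [Finset.prod_mul_distrib]
  congr 1
  simp [independent, ENNReal.toReal_prod]

/-- The sign of a re-sampled bit has expectation `p` in absolute value. -/
theorem abs_sum_smooth_sign (p : unitInterval) (x : Bool) :
    |∑ y : Bool, (smooth p x y).toReal * (if y then -1 else 1)| = p := by
  rw [sum_smooth_mul]
  cases x <;> simp [abs_of_nonneg p.2.1]

/-- The sign that tells whether a smoothed element lies in `S` has an expectation of at most
`1 - q |S| / N` in absolute value, where `q = 1 - p` and `N` is the size of the type. For `S` the
whole type the sign is constant, so an upper bound on `|S|` is needed. -/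
theorem abs_sum_smooth_mem_le [DecidableEq α] (p : unitInterval) (x : α) (S : Finset α)
    (hS : 3 * S.card ≤ 2 * Fintype.card α) :
    |∑ y, (smooth p x y).toReal * (if y ∈ S then -1 else 1)| ≤
      Real.exp (-((1 - p) / Fintype.card α)) ^ S.card := by
  have hp := p.2.1
  have hq : 0 ≤ 1 - (p : ℝ) := sub_nonneg.2 p.2.2
  have hN : (0 : ℝ) < Fintype.card α := by exact_mod_cast Fintype.card_pos_iff.2 ⟨x⟩
  have hS' : 3 * (S.card : ℝ) ≤ 2 * Fintype.card α := by exact_mod_cast hS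
  have hsum : ∑ y : α, (if y ∈ S then (-1 : ℝ) else 1) = Fintype.card α - 2 * S.card := by
    have : ∀ y : α, (if y ∈ S then (-1 : ℝ) else 1) = 1 - 2 * if y ∈ S then 1 else 0 := by
      intro y; split_ifs <;> norm_num
    simp [this, Finset.sum_sub_distrib, mul_comm]
  rw [sum_smooth_mul, hsum]
  have h1 : |(p : ℝ) * (if x ∈ S then -1 else 1)| = p := by
    split_ifs <;> simp [abs_of_nonneg hp]
  have h2 : |(1 - (p : ℝ)) / Fintype.card α * (Fintype.card α - 2 * S.card)| ≤
      (1 - p) / Fintype.card α * (Fintype.card α - S.card) := by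
    rw [abs_mul, abs_of_nonneg (div_nonneg hq hN.le)]
    refine mul_le_mul_of_nonneg_left ?_ (div_nonneg hq hN.le)
    rw [abs_le]
    have := Nat.cast_nonneg (α := ℝ) S.card
    constructor <;> linarith
  calc _ ≤ (p : ℝ) + (1 - p) / Fintype.card α * (Fintype.card α - S.card) :=
        (abs_add_le _ _).trans (by rw [h1]; gcongr)
    _ = -(S.card * ((1 - p) / Fintype.card α)) + 1 := by field_simp; ring
    _ ≤ Real.exp (-(S.card * ((1 - p) / Fintype.card α))) := Real.add_one_le_exp _
    _ = _ := by rw [← Real.exp_nat_mul]; congr 1; ring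

variable {V : Type} [Fintype V] {T : ℕ}

open Classical in
/-- The probability that the `p`-smoothed dynamic graph is the one given by `b` and `f`. -/
noncomputable def weight (p : unitInterval) {R : SimpleGraph V} (H₀ : SimpleGraph V)
    (e : Fin T → R.edgeSet) (x : (R.edgeSet → Bool) × (Fin T → R.edgeSet)) : ℝ :=
  (independent (fun d : R.edgeSet => smooth p (decide ((d : Sym2 V) ∈ H₀.edgeSet))) x.1).toReal *
    (independent (fun i : Fin T => smooth p (e i)) x.2).toReal

theorem weight_nonneg (p : unitInterval) {R : SimpleGraph V} (H₀ : SimpleGraph V)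
    (e : Fin T → R.edgeSet) (x : (R.edgeSet → Bool) × (Fin T → R.edgeSet)) :
    0 ≤ weight p H₀ e x := by unfold weight; positivity

open Classical in
theorem sum_weight (p : unitInterval) {R : SimpleGraph V} (H₀ : SimpleGraph V)
    (e : Fin T → R.edgeSet) : ∑ x, weight p H₀ e x = 1 := by
  simp only [weight, Fintype.sum_prod_type, ← Finset.mul_sum, sum_toReal_eq_one, mul_one]

open Classical in
theorem smoothedLaw_toReal (p : unitInterval) (R H₀ : SimpleGraph V) (e : Fin T → R.edgeSet)
    (s : Set (SimpleGraph V × List (Sym2 V))) :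
    ((smoothedLaw p R H₀ e).toOuterMeasure s).toReal =
      ∑ x, weight p H₀ e x *
        if (graphOf x.1, List.ofFn fun i => (x.2 i : Sym2 V)) ∈ s then 1 else 0 := by
  rw [smoothedLaw, PMF.toOuterMeasure_bind_apply, tsum_fintype, ENNReal.toReal_sum,
    Fintype.sum_prod_type]
  · refine Finset.sum_congr rfl fun b _ => ?_
    rw [PMF.toOuterMeasure_map_apply, PMF.toOuterMeasure_apply_fintype, ENNReal.toReal_mul,
      ENNReal.toReal_sum, Finset.mul_sum]
    · refine Finset.sum_congr rfl fun f _ => ?_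
      rw [weight, mul_assoc]
      congr 1
      by_cases h : (graphOf b, List.ofFn fun i => (f i : Sym2 V)) ∈ s <;> simp [Set.indicator, h]
    · intro f _
      refine ne_top_of_le_ne_top (PMF.apply_ne_top _ f) (Set.indicator_le_self _ _ _)
  · intro b _
    refine ENNReal.mul_ne_top (PMF.apply_ne_top _ b) (ne_top_of_le_ne_top ENNReal.one_ne_top ?_)
    rw [← (PMF.toOuterMeasure_apply_eq_one_iff _ _).2 (Set.subset_univ _)]
    exact MeasureTheory.measure_mono (Set.subset_univ _)

end Expectation

/-! ### Fourier bound for the absence of a set of edges -/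

section Fourier

variable {V : Type} [Fintype V] {T : ℕ} {R : SimpleGraph V}

/-- The graph after `t` changes, given the initial edges and the flipped node pairs. -/
def graphAt (x : (R.edgeSet → Bool) × (Fin T → R.edgeSet)) (t : ℕ) : SimpleGraph V :=
  flipEdges (graphOf x.1) ((List.ofFn fun i => (x.2 i : Sym2 V)).take t)

open Classical in
/-- The bias towards non-edges that is left after `t` changes of a `p`-smoothed dynamic graph on
the node pairs of `R`. -/
noncomputable def bias (p : unitInterval) (R : SimpleGraph V) (t : ℕ) : ℝ :=
  p * Real.exp (-((1 - p) / Fintype.card R.edgeSet)) ^ t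

theorem bias_nonneg (p : unitInterval) (t : ℕ) : 0 ≤ bias p R t :=
  mul_nonneg p.2.1 (pow_nonneg (Real.exp_pos _).le _)

open Classical in
/-- The Fourier coefficient of the law of `graphAt` at the character indexed by `S`. It factors over
the independent random choices: every pair of `S` contributes a factor `p` from the initial graph,
and every change a factor `exp (-q |S| / N)`. -/
theorem abs_sum_weight_mul_prod_edgeSign_le (p : unitInterval) (H₀ : SimpleGraph V)
    (e : Fin T → R.edgeSet) (S : Finset R.edgeSet)
    (hS : 3 * S.card ≤ 2 * Fintype.card R.edgeSet) {t : ℕ} (ht : t ≤ T) :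
    |∑ x, weight p H₀ e x * ∏ d ∈ S, edgeSign (graphAt x t) d| ≤ bias p R t ^ S.card := by
  have hsplit : ∀ x : (R.edgeSet → Bool) × (Fin T → R.edgeSet),
      ∏ d ∈ S, edgeSign (graphAt x t) d =
        (∏ d, if d ∈ S then (if x.1 d then (-1 : ℝ) else 1) else 1) *
          ∏ i : Fin T, if (i : ℕ) < t then (if x.2 i ∈ S then (-1 : ℝ) else 1) else 1 := by
    intro x
    simp only [graphAt, edgeSign_round]
    rw [Finset.prod_mul_distrib, Finset.prod_comm]
    congr 1
    · simp [Finset.prod_ite_mem]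
    · refine Finset.prod_congr rfl fun i _ => ?_
      by_cases hi : (i : ℕ) < t
      · simp [hi, Finset.prod_ite_eq]
      · simp [hi]
  have hfac : ∑ x, weight p H₀ e x * ∏ d ∈ S, edgeSign (graphAt x t) d =
      (∏ d : R.edgeSet, ∑ y, (smooth p (decide ((d : Sym2 V) ∈ H₀.edgeSet)) y).toReal *
        if d ∈ S then (if y then (-1 : ℝ) else 1) else 1) *
      ∏ i : Fin T, ∑ y, (smooth p (e i) y).toReal *
        if (i : ℕ) < t then (if y ∈ S then (-1 : ℝ) else 1) else 1 := by
    rw [← sum_independent_mul_prod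
        (fun d : R.edgeSet => smooth p (decide ((d : Sym2 V) ∈ H₀.edgeSet)))
        fun d y => if d ∈ S then (if y then (-1 : ℝ) else 1) else 1,
      ← sum_independent_mul_prod (fun i : Fin T => smooth p (e i))
        fun i y => if (i : ℕ) < t then (if y ∈ S then (-1 : ℝ) else 1) else 1,
      Finset.sum_mul_sum, Fintype.sum_prod_type]
    refine Finset.sum_congr rfl fun b _ => Finset.sum_congr rfl fun f _ => ?_
    rw [hsplit, weight]
    ring
  rw [hfac, abs_mul, Finset.abs_prod, Finset.abs_prod, bias, mul_pow]
  refine mul_le_mul ?_ ?_ (Finset.prod_nonneg fun _ _ => abs_nonneg _) (pow_nonneg p.2.1 _)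
  · have : ∀ d : R.edgeSet, |∑ y, (smooth p (decide ((d : Sym2 V) ∈ H₀.edgeSet)) y).toReal *
        if d ∈ S then (if y then (-1 : ℝ) else 1) else 1| = if d ∈ S then (p : ℝ) else 1 := by
      intro d
      by_cases hd : d ∈ S
      · simpa only [hd, if_true] using abs_sum_smooth_sign p _
      · simp only [hd, if_false, mul_one, sum_toReal_eq_one, abs_one]
    simp_rw [this]
    simp [Finset.prod_ite_mem]
  · calc _ ≤ ∏ i : Fin T, if (i : ℕ) < t then
          Real.exp (-((1 - p) / Fintype.card R.edgeSet)) ^ S.card else 1 := by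
          refine Finset.prod_le_prod (fun _ _ => abs_nonneg _) fun i _ => ?_
          by_cases hi : (i : ℕ) < t
          · simpa only [hi, if_true] using abs_sum_smooth_mem_le p (e i) S hS
          · simp only [hi, if_false, mul_one, sum_toReal_eq_one, abs_one, le_refl]
      _ = _ := by
          rw [Fin.prod_univ_eq_prod_range
              (fun i => if i < t then Real.exp (-((1 - (p : ℝ)) / Fintype.card R.edgeSet)) ^ S.card
                else 1) T,
            ← Finset.prod_filter, Finset.prod_const, ← pow_mul, ← pow_mul, mul_comm]
          congr 2
          have : (Finset.range T).filter (· < t) = Finset.range t := by ext; simp; omega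
          rw [this, Finset.card_range]

open Classical in
/-- The probability that no pair of `F` is an edge after `t` changes, by expansion of the indicator
function into characters. -/
theorem sum_weight_mul_prod_nonedge_le (p : unitInterval) (H₀ : SimpleGraph V)
    (e : Fin T → R.edgeSet) (F : Finset R.edgeSet)
    (hF : 3 * F.card ≤ 2 * Fintype.card R.edgeSet) {t : ℕ} (ht : t ≤ T) :
    ∑ x, weight p H₀ e x * ∏ d ∈ F, (1 + edgeSign (graphAt x t) d) / 2 ≤
      ((1 + bias p R t) / 2) ^ F.card := by
  have h1 : ∑ x, weight p H₀ e x * ∏ d ∈ F, (1 + edgeSign (graphAt x t) d) / 2 =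
      (∑ S ∈ F.powerset, ∑ x, weight p H₀ e x * ∏ d ∈ S, edgeSign (graphAt x t) d) /
        2 ^ F.card := by
    simp only [Finset.prod_div_distrib, Finset.prod_one_add, Finset.prod_const]
    rw [Finset.sum_comm, Finset.sum_div]
    refine Finset.sum_congr rfl fun x _ => ?_
    rw [← Finset.mul_sum, mul_div_assoc]
  rw [h1, div_pow]
  gcongr
  calc _ ≤ ∑ S ∈ F.powerset, bias p R t ^ S.card :=
        Finset.sum_le_sum fun S hS => (le_abs_self _).trans <|
          abs_sum_weight_mul_prod_edgeSign_le p H₀ e S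
            ((Nat.mul_le_mul_left 3 (Finset.card_le_card (Finset.mem_powerset.1 hS))).trans hF) ht
    _ = (1 + bias p R t) ^ F.card := by
        rw [← Finset.prod_const, Finset.prod_one_add]
        simp

open Classical in
/-- The union bound over all rounds and over a family of obstructions. -/
theorem one_sub_sum_le_smoothedLaw (p : unitInterval) (H₀ : SimpleGraph V) (e : Fin T → R.edgeSet)
    {ι : Type} (J : Finset ι) (F : ι → Finset R.edgeSet)
    (hF : ∀ j ∈ J, 3 * (F j).card ≤ 2 * Fintype.card R.edgeSet)
    (good : Set (SimpleGraph V × List (Sym2 V)))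
    (hgood : ∀ x : (R.edgeSet → Bool) × (Fin T → R.edgeSet),
      (∀ t ≤ T, ∀ j ∈ J, ∃ d ∈ F j, (d : Sym2 V) ∈ (graphAt x t).edgeSet) →
        (graphOf x.1, List.ofFn fun i => (x.2 i : Sym2 V)) ∈ good) :
    1 - ∑ t ∈ Finset.range (T + 1), ∑ j ∈ J, ((1 + bias p R t) / 2) ^ (F j).card ≤
      ((smoothedLaw p R H₀ e).toOuterMeasure good).toReal := by
  have hnn : ∀ (x : (R.edgeSet → Bool) × (Fin T → R.edgeSet)) (t : ℕ) (j : ι),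
      0 ≤ ∏ d ∈ F j, (1 + edgeSign (graphAt x t) d) / 2 := fun x t j =>
    Finset.prod_nonneg fun d _ => by unfold edgeSign; split_ifs <;> norm_num
  have hpt : ∀ x : (R.edgeSet → Bool) × (Fin T → R.edgeSet),
      1 - ∑ t ∈ Finset.range (T + 1), ∑ j ∈ J, ∏ d ∈ F j, (1 + edgeSign (graphAt x t) d) / 2 ≤
        if (graphOf x.1, List.ofFn fun i => (x.2 i : Sym2 V)) ∈ good then 1 else 0 := by
    intro x
    split_ifs with hx
    · exact sub_le_self _ (Finset.sum_nonneg fun t _ => Finset.sum_nonneg fun j _ => hnn x t j)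
    · obtain ⟨t, ht, j, hj, hd⟩ : ∃ t ≤ T, ∃ j ∈ J, ∀ d ∈ F j,
          (d : Sym2 V) ∉ (graphAt x t).edgeSet := by
        by_contra! hcon
        exact hx (hgood x hcon)
      have h1 : ∏ d ∈ F j, (1 + edgeSign (graphAt x t) d) / 2 = 1 :=
        Finset.prod_eq_one fun d hdF => by simp [edgeSign, hd d hdF]
      have h2 := Finset.single_le_sum (fun j _ => hnn x t j) hj
      have h3 := Finset.single_le_sum
        (fun t _ => Finset.sum_nonneg fun j (_ : j ∈ J) => hnn x t j)
        (Finset.mem_range.2 (Nat.lt_succ_of_le ht))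
      linarith
  rw [smoothedLaw_toReal]
  calc _ ≤ 1 - ∑ t ∈ Finset.range (T + 1), ∑ j ∈ J, ∑ x, weight p H₀ e x *
          ∏ d ∈ F j, (1 + edgeSign (graphAt x t) d) / 2 := by
        refine sub_le_sub_left (Finset.sum_le_sum fun t ht => Finset.sum_le_sum fun j hj => ?_) _
        exact sum_weight_mul_prod_nonedge_le p H₀ e (F j) (hF j hj)
          (Nat.lt_succ_iff.1 (Finset.mem_range.1 ht))
    _ = ∑ x, weight p H₀ e x * (1 - ∑ t ∈ Finset.range (T + 1), ∑ j ∈ J,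
          ∏ d ∈ F j, (1 + edgeSign (graphAt x t) d) / 2) := by
        simp only [mul_sub, mul_one, Finset.sum_sub_distrib, sum_weight, Finset.mul_sum]
        congr 1
        rw [Finset.sum_comm]
        simp only [Finset.sum_comm (s := J)]
        rw [Finset.sum_comm]
    _ ≤ _ := Finset.sum_le_sum fun x _ =>
        mul_le_mul_of_nonneg_left (hpt x) (weight_nonneg p H₀ e x)

end Fourier

/-! ### Summing up the error probabilities -/

section Estimates

/-- The hypothesis `26 log n < n` excludes all small `n ≥ 2`. -/
theorem le_of_log_lt {n : ℕ} (hn : 2 ≤ n) (h : 26 * Real.log n < n) : 108 ≤ n := by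
  have hlog2 := Real.log_two_gt_d9
  -- a lower bound `2 ^ k` for `n` improves itself
  have key : ∀ k m : ℕ, 2 ^ k ≤ n → (m : ℝ) < 26 * (k * 0.6931471803) → m < n := by
    intro k m hk hm
    have h1 : (k : ℝ) * Real.log 2 ≤ Real.log n := by
      rw [← Real.log_pow]
      exact Real.log_le_log (by positivity) (by exact_mod_cast hk)
    have h2 : (k : ℝ) * 0.6931471803 ≤ k * Real.log 2 := by gcongr
    have : (m : ℝ) < n := by linarith
    exact_mod_cast this
  have h1 : 18 < n := key 1 18 (by omega) (by norm_num)
  have h2 : 72 < n := key 4 72 (by omega) (by norm_num)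
  have h3 : 108 < n := key 6 108 (by omega) (by norm_num)
  omega

/-- The numerical heart of the union bound: `n ^ 3` early rounds, each of which fails with
probability at most `4 n * n ^ (-6)`, and at most `2 ^ (n / 3) + 1` late rounds, each of which fails
with probability at most `4 n * exp (1 / 2 - n log 2 / 2)`. -/
theorem early_add_late_le {n : ℕ} (hn : 108 ≤ n) (h : 26 * Real.log n < n) {T : ℕ}
    (hT : (T : ℝ) ≤ (2 : ℝ) ^ ((n : ℝ) / 3)) :
    (n : ℝ) ^ 3 * (4 * n * Real.exp (-6 * Real.log n)) +
      (T + 1) * (4 * n * Real.exp (1 / 2 - n * Real.log 2 / 2)) ≤ 1 / n := by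
  have hn' : (108 : ℝ) ≤ n := by exact_mod_cast hn
  have hn0 : (0 : ℝ) < n := by linarith
  have hlog2 := Real.log_two_gt_d9
  have he6 : Real.exp (-6 * Real.log n) = 1 / (n : ℝ) ^ 6 := by
    rw [show -6 * Real.log (n : ℝ) = -((6 : ℕ) * Real.log n) by norm_num, ← Real.log_pow,
      Real.exp_neg, Real.exp_log (by positivity), one_div]
  have hT1 : (T : ℝ) + 1 ≤ 2 * Real.exp (n * Real.log 2 / 3) := by
    have h2 : (2 : ℝ) ^ ((n : ℝ) / 3) = Real.exp (n * Real.log 2 / 3) := by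
      rw [Real.rpow_def_of_pos (by norm_num)]
      congr 1
      ring
    have h1 : 1 ≤ Real.exp (n * Real.log 2 / 3) := Real.one_le_exp (by positivity)
    linarith [h2 ▸ hT]
  have he3 : (16 : ℝ) ≤ Real.exp 3 := by
    have h1 := Real.exp_one_gt_d9
    have h2 : Real.exp 3 = Real.exp 1 ^ 3 := by rw [← Real.exp_nat_mul]; norm_num
    rw [h2]
    calc (16 : ℝ) ≤ 2.7 ^ 3 := by norm_num
      _ ≤ _ := by gcongr; linarith
  have hlate : Real.exp (n * Real.log 2 / 3) * Real.exp (1 / 2 - n * Real.log 2 / 2) ≤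
      1 / (16 * (n : ℝ) ^ 2) := by
    have hn2 : (n : ℝ) ^ 2 = Real.exp (2 * Real.log n) := by
      rw [show 2 * Real.log (n : ℝ) = (2 : ℕ) * Real.log n by norm_num, ← Real.log_pow,
        Real.exp_log (by positivity)]
    have h1 : Real.exp (n * Real.log 2 / 3) * Real.exp (1 / 2 - n * Real.log 2 / 2) ≤
        Real.exp (-(3 + 2 * Real.log n)) := by
      rw [← Real.exp_add, Real.exp_le_exp]
      nlinarith
    refine h1.trans ?_
    rw [Real.exp_neg, one_div, Real.exp_add, ← hn2]
    gcongr
  have hA : (n : ℝ) ^ 3 * (4 * n * Real.exp (-6 * Real.log n)) = 4 / n * (1 / n) := by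
    rw [he6]; field_simp
  have hB : ((T : ℝ) + 1) * (4 * n * Real.exp (1 / 2 - n * Real.log 2 / 2)) ≤ 1 / 2 * (1 / n) := by
    calc _ ≤ 2 * Real.exp (n * Real.log 2 / 3) *
          (4 * n * Real.exp (1 / 2 - n * Real.log 2 / 2)) := by gcongr
      _ = 8 * n * (Real.exp (n * Real.log 2 / 3) * Real.exp (1 / 2 - n * Real.log 2 / 2)) := by ring
      _ ≤ 8 * n * (1 / (16 * (n : ℝ) ^ 2)) := by gcongr
      _ = _ := by field_simp; norm_num
  have h4 : 4 / (n : ℝ) ≤ 1 / 2 := by rw [div_le_div_iff₀ hn0 (by norm_num)]; linarith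
  rw [hA]
  have := mul_le_mul_of_nonneg_right h4 (one_div_nonneg.2 hn0.le)
  linarith

/-- The property `P` holds for every graph in `R` that has an edge in each set `F j` of a finite
family of obstructions. The sets are not too close to the set of all node pairs, and the family is
small: if a set of `k` node pairs is avoided with probability at most `(s ^ 2) ^ k`, then the union
bound over the family is `O (n * s ^ n)`. The square spares a square root: the number of pairs is
only known to be at least `n / 2` times the number of nodes on the smaller side. -/
def HasObstructions {V : Type} (n : ℕ) (R : SimpleGraph V)
    (P : SimpleGraph V → Prop) : Prop :=
  0 < Nat.card R.edgeSet ∧ Nat.card R.edgeSet ≤ n ^ 2 ∧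
    ∃ (ι : Type) (J : Finset ι) (F : ι → Finset R.edgeSet),
      (∀ j ∈ J, 3 * (F j).card ≤ 2 * Nat.card R.edgeSet) ∧
      (∀ s : ℝ, 0 ≤ s → s ≤ 1 → (n : ℝ) ^ 2 * s ^ n ≤ 1 →
        ∑ j ∈ J, (s ^ 2) ^ (F j).card ≤ 4 * n * s ^ n) ∧
      ∀ G ≤ R, (∀ j ∈ J, ∃ d ∈ F j, (d : Sym2 V) ∈ G.edgeSet) → P G

theorem HasObstructions.mono {V : Type} {n : ℕ} {R : SimpleGraph V}
    {P P' : SimpleGraph V → Prop} (h : HasObstructions n R P) (hPP' : ∀ G ≤ R, P G → P' G) :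
    HasObstructions n R P' := by
  obtain ⟨h1, h2, ι, J, F, h3, h4, h5⟩ := h
  exact ⟨h1, h2, ι, J, F, h3, h4, fun G hG hJ => hPP' G hG (h5 G hG hJ)⟩

theorem bias_le_left {V : Type} [Fintype V] {R : SimpleGraph V} (p : unitInterval) (t : ℕ) :
    bias p R t ≤ p :=
  mul_le_of_le_one_right p.2.1 <| pow_le_one₀ (Real.exp_pos _).le <| Real.exp_le_one_iff.2 <|
    neg_nonpos.2 <| div_nonneg (sub_nonneg.2 p.2.2) (Nat.cast_nonneg _)

open Classical in
/-- After `n ^ 3` changes the bias has been washed out. -/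
theorem bias_le_one_div {V : Type} [Fintype V] {R : SimpleGraph V} (p : unitInterval) {n t : ℕ}
    (hn : 1 ≤ n) (hR : 0 < Fintype.card R.edgeSet) (hRn : Fintype.card R.edgeSet ≤ n ^ 2)
    (hp : Real.log n ≤ (1 - p) * n) (ht : n ^ 3 ≤ t) : bias p R t ≤ 1 / n := by
  have hn0 : (0 : ℝ) < n := by exact_mod_cast hn
  have hR' : (0 : ℝ) < Fintype.card R.edgeSet := by exact_mod_cast hR
  have hq : 0 ≤ 1 - (p : ℝ) := sub_nonneg.2 p.2.2
  have h1 : Real.log n ≤ t * ((1 - p) / Fintype.card R.edgeSet) := by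
    refine hp.trans ?_
    rw [mul_div_assoc', le_div_iff₀ hR']
    calc (1 - (p : ℝ)) * n * Fintype.card R.edgeSet ≤ (1 - p) * n * ((n ^ 2 : ℕ) : ℝ) := by
          gcongr
      _ = ((n ^ 3 : ℕ) : ℝ) * (1 - p) := by push_cast; ring
      _ ≤ t * (1 - p) := by gcongr
  calc bias p R t ≤ 1 * Real.exp (-((1 - p) / Fintype.card R.edgeSet)) ^ t :=
        mul_le_mul_of_nonneg_right p.2.2 (by positivity)
    _ = Real.exp (-(t * ((1 - p) / Fintype.card R.edgeSet))) := by
        rw [one_mul, ← Real.exp_nat_mul]; congr 1; ring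
    _ ≤ Real.exp (-Real.log n) := Real.exp_le_exp.2 (neg_le_neg h1)
    _ = 1 / n := by rw [Real.exp_neg, Real.exp_log hn0, one_div]

/-- A property with few obstructions holds in all rounds with probability at least `1 - 1 / n`. -/
theorem HasObstructions.le_smoothedLaw {V : Type} [Fintype V] {n : ℕ} {R : SimpleGraph V}
    {P : SimpleGraph V → Prop} (hP : HasObstructions n R P) (hn : 108 ≤ n) (p : unitInterval)
    (hp : (p : ℝ) < 1 - 26 * Real.log n / n) {T : ℕ} (hT : (T : ℝ) ≤ (2 : ℝ) ^ ((n : ℝ) / 3))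
    (H₀ : SimpleGraph V) (e : Fin T → R.edgeSet) :
    1 - 1 / (n : ℝ) ≤ ((smoothedLaw p R H₀ e).toOuterMeasure
      {g | ∀ t ≤ g.2.length, P (flipEdges g.1 (g.2.take t))}).toReal := by
  classical
  obtain ⟨hR, hRn, ι, J, F, hF, hsum, hPG⟩ := hP
  rw [Nat.card_eq_fintype_card] at hR hRn
  simp only [Nat.card_eq_fintype_card] at hF
  have hn' : (108 : ℝ) ≤ n := by exact_mod_cast hn
  have hn0 : (0 : ℝ) < n := by linarith
  have hp0 := p.2.1
  have hlogn : 0 ≤ Real.log n := Real.log_nonneg (by linarith)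
  have hq : 26 * Real.log n < (1 - p) * n := by
    rw [← div_lt_iff₀ hn0]; linarith
  have hnlog : 26 * Real.log n < n := hq.trans_le (mul_le_of_le_one_left hn0.le (by linarith))
  have hlog2 := Real.log_two_gt_d9
  have hbase : ∀ (s : ℝ) (t : ℕ), 0 ≤ s → s ≤ 1 → (n : ℝ) ^ 2 * s ^ n ≤ 1 →
      (1 + bias p R t) / 2 ≤ s ^ 2 →
      ∑ j ∈ J, ((1 + bias p R t) / 2) ^ (F j).card ≤ 4 * n * s ^ n := by
    intro s t hs0 hs1 hs hb
    refine le_trans (Finset.sum_le_sum fun j _ => ?_) (hsum s hs0 hs1 hs)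
    have := bias_nonneg (R := R) p t
    gcongr
  have hexp2 : (n : ℝ) ^ 2 = Real.exp (2 * Real.log n) := by
    rw [show 2 * Real.log (n : ℝ) = (2 : ℕ) * Real.log n by norm_num, ← Real.log_pow,
      Real.exp_log (by positivity)]
  have hround : ∀ t, ∑ j ∈ J, ((1 + bias p R t) / 2) ^ (F j).card ≤
      if t < n ^ 3 then 4 * n * Real.exp (-6 * Real.log n)
      else 4 * n * Real.exp (1 / 2 - n * Real.log 2 / 2) := by
    intro t
    split_ifs with ht
    · -- early rounds: every pair is an edge with probability at least `q / 2`
      have hs : Real.exp (-(1 - p) / 4) ^ n ≤ Real.exp (-6 * Real.log n) := by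
        rw [← Real.exp_nat_mul, Real.exp_le_exp]
        linarith
      refine (hbase (Real.exp (-(1 - p) / 4)) t (Real.exp_pos _).le
        (Real.exp_le_one_iff.2 (by linarith [p.2.2])) ?_ ?_).trans (by gcongr)
      · refine (mul_le_mul_of_nonneg_left hs (by positivity)).trans ?_
        rw [hexp2, ← Real.exp_add, Real.exp_le_one_iff]
        linarith
      · rw [← Real.exp_nat_mul]
        have h1 := bias_le_left (R := R) p t
        have h2 := Real.add_one_le_exp (((2 : ℕ) : ℝ) * (-(1 - (p : ℝ)) / 4))
        push_cast at h2 ⊢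
        linarith
    · -- late rounds: every pair is an edge with probability about `1 / 2`
      have hinv : 1 / (n : ℝ) ≤ 1 / 108 := one_div_le_one_div_of_le (by norm_num) hn'
      have hs : Real.exp ((1 / n - Real.log 2) / 2) ^ n =
          Real.exp (1 / 2 - n * Real.log 2 / 2) := by
        rw [← Real.exp_nat_mul]
        congr 1
        field_simp
      rw [← hs]
      refine hbase _ t (Real.exp_pos _).le (Real.exp_le_one_iff.2 (by linarith)) ?_ ?_
      · rw [hs, hexp2, ← Real.exp_add, Real.exp_le_one_iff]
        nlinarith
      · have h1 := bias_le_one_div (R := R) p (by omega) hR hRn (by linarith) (not_lt.1 ht)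
        have h2 : Real.exp ((1 / n - Real.log 2) / 2) ^ 2 = Real.exp (1 / n) / 2 := by
          rw [← Real.exp_nat_mul, Nat.cast_ofNat, mul_div_cancel₀ _ two_ne_zero, Real.exp_sub,
            Real.exp_log two_pos]
        have h3 := Real.add_one_le_exp (1 / (n : ℝ))
        rw [h2]
        linarith
  have htotal : ∑ t ∈ Finset.range (T + 1), ∑ j ∈ J, ((1 + bias p R t) / 2) ^ (F j).card ≤
      1 / n := by
    refine le_trans ?_ (early_add_late_le hn hnlog hT)
    refine (Finset.sum_le_sum fun t _ => hround t).trans ?_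
    rw [Finset.sum_ite, Finset.sum_const, Finset.sum_const, nsmul_eq_mul, nsmul_eq_mul]
    have h1 : ((Finset.range (T + 1)).filter (· < n ^ 3)).card ≤ n ^ 3 := by
      conv_rhs => rw [← Finset.card_range (n ^ 3)]
      exact Finset.card_le_card fun t ht => Finset.mem_range.2 (Finset.mem_filter.1 ht).2
    have h2 : ((Finset.range (T + 1)).filter (¬ · < n ^ 3)).card ≤ T + 1 := by
      simpa using Finset.card_filter_le (Finset.range (T + 1)) (¬ · < n ^ 3)
    gcongr
    · exact_mod_cast h1
    · exact_mod_cast h2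
  refine le_trans (sub_le_sub_left htotal 1)
    (one_sub_sum_le_smoothedLaw p H₀ e J F hF _ fun x hx t ht => ?_)
  rw [List.length_ofFn] at ht
  refine hPG _ (flipEdges_le _ _ (graphOf_le _) fun d hd => ?_) (hx t ht)
  obtain ⟨i, rfl⟩ := (List.mem_ofFn' _ _).1 (List.mem_of_mem_take hd)
  exact (x.2 i).2

end Estimates

/-! ### Obstructions to connectivity and to perfect matchings -/

section Obstructions

open Classical in
/-- The node pairs of `R` between `A` and `B`. -/
noncomputable def crossing {V : Type} [Fintype V] (R : SimpleGraph V) (A B : Finset V) :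
    Finset R.edgeSet :=
  Finset.univ.filter fun d => ∃ a ∈ A, ∃ b ∈ B, (d : Sym2 V) = s(a, b)

theorem mem_crossing {V : Type} [Fintype V] {R : SimpleGraph V} {A B : Finset V}
    {d : R.edgeSet} : d ∈ crossing R A B ↔ ∃ a ∈ A, ∃ b ∈ B, (d : Sym2 V) = s(a, b) := by
  simp [crossing]

theorem card_crossing {V : Type} [Fintype V] {R : SimpleGraph V} {A B : Finset V}
    (hAB : Disjoint A B) (h : ∀ a ∈ A, ∀ b ∈ B, R.Adj a b) :
    (crossing R A B).card = A.card * B.card := by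
  rw [← Finset.card_product]
  symm
  refine Finset.card_bij
    (fun x hx => ⟨s(x.1, x.2), h _ (Finset.mem_product.1 hx).1 _ (Finset.mem_product.1 hx).2⟩)
    ?_ ?_ ?_
  · intro x hx
    rw [Finset.mem_product] at hx
    exact mem_crossing.2 ⟨x.1, hx.1, x.2, hx.2, rfl⟩
  · intro x hx y hy hxy
    rw [Finset.mem_product] at hx hy
    rcases Sym2.eq_iff.1 (Subtype.ext_iff.1 hxy) with h1 | h1
    · exact Prod.ext h1.1 h1.2
    · exact absurd (h1.1 ▸ hx.1) (Finset.disjoint_right.1 hAB hy.2)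
  · intro d hd
    obtain ⟨a, ha, b, hb, hd⟩ := mem_crossing.1 hd
    exact ⟨(a, b), Finset.mem_product.2 ⟨ha, hb⟩, Subtype.ext hd.symm⟩

theorem exists_adj_of_mem_crossing {V : Type} [Fintype V] {R G : SimpleGraph V} {A B : Finset V}
    (h : ∃ d ∈ crossing R A B, (d : Sym2 V) ∈ G.edgeSet) : ∃ a ∈ A, ∃ b ∈ B, G.Adj a b := by
  obtain ⟨d, hd, hG⟩ := h
  obtain ⟨a, ha, b, hb, hd⟩ := mem_crossing.1 hd
  exact ⟨a, ha, b, hb, by rwa [hd] at hG⟩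

theorem sum_nonempty_pow_card_le {n : ℕ} {u : ℝ} (hu : 0 ≤ u) (hnu : n * u ≤ 1) :
    ∑ S : Finset (Fin n) with S.Nonempty, u ^ S.card ≤ 2 * n * u := by
  have h1 : ∑ S : Finset (Fin n), u ^ S.card = (1 + u) ^ n := by
    have := Fintype.sum_pow_mul_eq_add_pow (Fin n) u 1
    simpa [add_comm] using this
  have h2 : ∑ S : Finset (Fin n) with S.Nonempty, u ^ S.card = (1 + u) ^ n - 1 := by
    rw [← h1, ← Finset.sum_filter_add_sum_filter_not Finset.univ Finset.Nonempty]
    simp [Finset.not_nonempty_iff_eq_empty, Finset.filter_eq']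
  have h3 : (1 + u) ^ n ≤ Real.exp (n * u) := by
    rw [Real.exp_nat_mul]
    gcongr
    linarith [Real.add_one_le_exp u]
  have h4 : |Real.exp (n * u) - 1| ≤ 2 * |n * u| :=
    Real.abs_exp_sub_one_le (by rwa [abs_of_nonneg (by positivity)])
  rw [abs_of_nonneg (by positivity : (0 : ℝ) ≤ n * u)] at h4
  linarith [le_abs_self (Real.exp (n * u) - 1)]

/-- A graph is connected if every cut whose smaller side has at most half of the nodes is crossed
by an edge. -/
theorem connected_of_cuts {n : ℕ} (hn : 1 ≤ n) (G : SimpleGraph (Fin n))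
    (h : ∀ S : Finset (Fin n), S.Nonempty → 2 * S.card ≤ n → ∃ a ∈ S, ∃ b ∈ Sᶜ, G.Adj a b) :
    G.Connected := by
  classical
  have : Nonempty (Fin n) := ⟨⟨0, hn⟩⟩
  refine ⟨fun u v => ?_⟩
  by_contra huv
  set C : Finset (Fin n) := Finset.univ.filter (G.Reachable u) with hC
  have hmem : ∀ x, x ∈ C ↔ G.Reachable u x := by simp [hC]
  have hcut : ∀ a ∈ C, ∀ b ∉ C, ¬ G.Adj a b := fun a ha b hb hab =>
    hb ((hmem b).2 (((hmem a).1 ha).trans hab.reachable))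
  have hcard : C.card + Cᶜ.card = n := by simp [Finset.card_add_card_compl]
  rcases le_or_gt (2 * C.card) n with h1 | h1
  · obtain ⟨a, ha, b, hb, hab⟩ := h C ⟨u, (hmem u).2 (SimpleGraph.Reachable.refl u)⟩ h1
    exact hcut a ha b (Finset.mem_compl.1 hb) hab
  · obtain ⟨a, ha, b, hb, hab⟩ := h Cᶜ ⟨v, Finset.mem_compl.2 fun hv => huv ((hmem v).1 hv)⟩
      (by omega)
    rw [compl_compl] at hb
    exact hcut b hb a (Finset.mem_compl.1 ha) hab.symm

theorem hasObstructions_connected {n : ℕ} (hn : 4 ≤ n) :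
    HasObstructions n (⊤ : SimpleGraph (Fin n)) SimpleGraph.Connected := by
  classical
  have hn' : (4 : ℝ) ≤ n := by exact_mod_cast hn
  have hN : 2 * Nat.card (⊤ : SimpleGraph (Fin n)).edgeSet = n * (n - 1) := by
    have h := SimpleGraph.card_edgeFinset_top_eq_card_choose_two (V := Fin n)
    rw [SimpleGraph.edgeFinset, Set.toFinset_card, Fintype.card_fin, Nat.choose_two_right,
      ← Nat.card_eq_fintype_card] at h
    rw [h, mul_comm, Nat.div_mul_cancel (Nat.even_mul_pred_self n).two_dvd]
  obtain ⟨m, rfl⟩ : ∃ m, n = m + 1 := ⟨n - 1, by omega⟩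
  rw [Nat.add_sub_cancel] at hN
  have hcard : ∀ S : Finset (Fin (m + 1)),
      (crossing ⊤ S Sᶜ).card = S.card * (m + 1 - S.card) := fun S => by
    rw [card_crossing disjoint_compl_right, Finset.card_compl, Fintype.card_fin]
    intro a ha b hb
    rw [SimpleGraph.top_adj]
    rintro rfl
    exact (Finset.mem_compl.1 hb) ha
  refine ⟨?_, ?_, Finset (Fin (m + 1)),
    Finset.univ.filter fun S => S.Nonempty ∧ 2 * S.card ≤ m + 1, fun S => crossing ⊤ S Sᶜ,
    ?_, ?_, ?_⟩
  · nlinarith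
  · nlinarith
  · intro S hS
    obtain ⟨k, hk⟩ : ∃ k, m + 1 = S.card + k :=
      ⟨m + 1 - S.card, by have := (Finset.mem_filter.1 hS).2.2; omega⟩
    rw [hcard, hN, show m + 1 - S.card = k by omega]
    zify at hk hn ⊢
    nlinarith [sq_nonneg ((S.card : ℤ) - k)]
  · intro s hs0 hs1 hs
    have hu : (0 : ℝ) ≤ s ^ (m + 1) := pow_nonneg hs0 _
    have hnu : ((m + 1 : ℕ) : ℝ) * s ^ (m + 1) ≤ 1 := by
      refine le_trans (mul_le_mul_of_nonneg_right ?_ hu) hs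
      nlinarith
    calc _ ≤ ∑ S : Finset (Fin (m + 1)) with S.Nonempty ∧ 2 * S.card ≤ m + 1,
          (s ^ (m + 1)) ^ S.card := by
          refine Finset.sum_le_sum fun S hS => ?_
          have hS2 := (Finset.mem_filter.1 hS).2.2
          rw [hcard, ← pow_mul, ← pow_mul]
          refine pow_le_pow_of_le_one hs0 hs1 ?_
          calc (m + 1) * S.card ≤ (2 * (m + 1 - S.card)) * S.card :=
                Nat.mul_le_mul_right _ (by omega)
            _ = _ := by ring
      _ ≤ ∑ S : Finset (Fin (m + 1)) with S.Nonempty, (s ^ (m + 1)) ^ S.card := by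
          refine Finset.sum_le_sum_of_subset_of_nonneg
            (Finset.monotone_filter_right _ fun S _ hS => hS.1) fun _ _ _ => pow_nonneg hu _
      _ ≤ 2 * (m + 1 : ℕ) * s ^ (m + 1) := sum_nonempty_pow_card_le hu hnu
      _ ≤ _ := by gcongr; norm_num
  · intro G _ h
    exact connected_of_cuts (by omega) G fun S hS hS2 =>
      exists_adj_of_mem_crossing (h S (Finset.mem_filter.2 ⟨Finset.mem_univ _, hS, hS2⟩))

/-- A perfect matching of a graph on `Fin n ⊕ Fin n`, as a bijection between the two sides. -/
def HasMatchingEquiv (n : ℕ) (G : SimpleGraph (Fin n ⊕ Fin n)) : Prop :=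
  ∃ f : Fin n ≃ Fin n, ∀ a, G.Adj (.inl a) (.inr (f a))

/-- Hall's theorem, with Hall violators in the symmetric form of a pair of sets with `n + 1` nodes
in total and without an edge in between. -/
theorem hasMatchingEquiv_of_hall {n : ℕ} (G : SimpleGraph (Fin n ⊕ Fin n))
    (h : ∀ S T : Finset (Fin n), S.card + T.card = n + 1 →
      ∃ a ∈ S, ∃ b ∈ T, G.Adj (.inl a) (.inr b)) : HasMatchingEquiv n G := by
  classical
  have key : ∀ S B : Finset (Fin n), (∀ b, b ∈ B ↔ ∃ a ∈ S, G.Adj (.inl a) (.inr b)) →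
      S.card ≤ B.card := by
    intro S B hB
    by_contra! hlt
    have hS : S.card ≤ n := by simpa using S.card_le_univ
    have hBc : Bᶜ.card = n - B.card := by rw [Finset.card_compl, Fintype.card_fin]
    obtain ⟨T, hT, hTcard⟩ := Finset.exists_subset_card_eq (s := Bᶜ) (n := n + 1 - S.card)
      (by omega)
    obtain ⟨a, ha, b, hb, hab⟩ := h S T (by omega)
    exact Finset.mem_compl.1 (hT hb) ((hB b).2 ⟨a, ha, hab⟩)
  obtain ⟨f, hf, hadj⟩ := (Fintype.all_card_le_filter_rel_iff_exists_injective
    fun a b : Fin n => G.Adj (.inl a) (.inr b)).1 fun S => by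
      refine key S _ fun b => ?_
      simp
  exact ⟨Equiv.ofBijective f (Finite.injective_iff_bijective.1 hf), hadj⟩

/-- There are at most `n ^ (k - 1)` sets `T` that complement a set of `k ≥ 1` nodes to a pair with
`n + 1` nodes in total, so the sum reduces to `sum_nonempty_pow_card_le` for `n * u`. -/
theorem sum_hall_pow_card_le {n : ℕ} (hn : 1 ≤ n) {u : ℝ} (hu : 0 ≤ u)
    (hnu : (n : ℝ) ^ 2 * u ≤ 1) :
    ∑ x : Finset (Fin n) × Finset (Fin n) with x.1.card + x.2.card = n + 1, u ^ x.1.card ≤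
      2 * n * u := by
  have hn0 : (0 : ℝ) < n := by exact_mod_cast hn
  have hT : ∀ S : Finset (Fin n),
      ∑ T : Finset (Fin n), (if S.card + T.card = n + 1 then u ^ S.card else 0) ≤
        if S.Nonempty then (n * u) ^ S.card / n else 0 := by
    intro S
    have hS : S.card ≤ n := by simpa using S.card_le_univ
    rw [← Finset.sum_filter, Finset.sum_const, nsmul_eq_mul]
    split_ifs with hne
    · have hpos := hne.card_pos
      have hcount : (Finset.univ.filter fun T : Finset (Fin n) => S.card + T.card = n + 1).card ≤
          n ^ (S.card - 1) := by
        have : (Finset.univ.filter fun T : Finset (Fin n) => S.card + T.card = n + 1) =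
            Finset.powersetCard (n - (S.card - 1)) Finset.univ := by
          ext T
          simp only [Finset.mem_filter, Finset.mem_univ, true_and, Finset.mem_powersetCard,
            Finset.subset_univ]
          omega
        rw [this, Finset.card_powersetCard, Finset.card_univ, Fintype.card_fin,
          Nat.choose_symm (by omega)]
        exact Nat.choose_le_pow _ _
      rw [le_div_iff₀ hn0]
      calc _ ≤ ((n ^ (S.card - 1) : ℕ) : ℝ) * u ^ S.card * n := by gcongr
        _ = ((n : ℝ) ^ (S.card - 1) * n) * u ^ S.card := by push_cast; ring
        _ = _ := by rw [← pow_succ, Nat.sub_add_cancel hpos, mul_pow]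
    · rw [Finset.not_nonempty_iff_eq_empty] at hne
      subst hne
      have : (Finset.univ.filter fun T : Finset (Fin n) =>
          (∅ : Finset (Fin n)).card + T.card = n + 1) = ∅ := by
        refine Finset.filter_eq_empty_iff.2 fun T _ => ?_
        have : T.card ≤ n := by simpa using T.card_le_univ
        rw [Finset.card_empty]
        omega
      rw [this]
      simp
  rw [Finset.sum_filter, Fintype.sum_prod_type]
  refine (Finset.sum_le_sum fun S _ => hT S).trans ?_
  rw [← Finset.sum_filter, ← Finset.sum_div, div_le_iff₀ hn0]
  have := sum_nonempty_pow_card_le (n := n) (u := n * u) (by positivity) (by linarith)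
  linarith

theorem hasObstructions_hasMatchingEquiv {n : ℕ} (hn : 4 ≤ n) :
    HasObstructions n (completeBipartiteGraph (Fin n) (Fin n)) (HasMatchingEquiv n) := by
  classical
  have hdisj : ∀ S T : Finset (Fin n),
      Disjoint (S.map (Function.Embedding.inl (β := Fin n)))
        (T.map (Function.Embedding.inr (α := Fin n))) := fun S T => by
    simp [Finset.disjoint_left]
  have hcard : ∀ S T : Finset (Fin n), (crossing (completeBipartiteGraph (Fin n) (Fin n))
      (S.map .inl) (T.map .inr)).card = S.card * T.card := fun S T => by
    rw [card_crossing (hdisj S T), Finset.card_map, Finset.card_map]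
    simp
  have hN : Nat.card (completeBipartiteGraph (Fin n) (Fin n)).edgeSet = n * n := by
    have h := hcard Finset.univ Finset.univ
    rw [Finset.card_univ, Fintype.card_fin] at h
    rw [← h, Nat.card_eq_fintype_card, ← Finset.card_univ]
    congr 1
    symm
    rw [Finset.eq_univ_iff_forall]
    rintro ⟨d, hd⟩
    induction d with | _ x y => ?_
    refine mem_crossing.2 ?_
    rcases x with x | x <;> rcases y with y | y <;> simp at hd ⊢
  refine ⟨?_, ?_, Finset (Fin n) × Finset (Fin n),
    Finset.univ.filter fun x => x.1.card + x.2.card = n + 1,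
    fun x => crossing _ (x.1.map .inl) (x.2.map .inr), ?_, ?_, ?_⟩
  · rw [hN]; positivity
  · rw [hN, sq]
  · rintro ⟨S, T⟩ hST
    have h := (Finset.mem_filter.1 hST).2
    rw [hcard, hN]
    dsimp only at h ⊢
    zify at h hn ⊢
    nlinarith [sq_nonneg ((S.card : ℤ) - T.card)]
  · intro s hs0 hs1 hs
    have hu : (0 : ℝ) ≤ s ^ n := pow_nonneg hs0 _
    have h1 := sum_hall_pow_card_le (by omega) hu hs
    have h2 : ∑ x : Finset (Fin n) × Finset (Fin n) with x.1.card + x.2.card = n + 1,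
        (s ^ n) ^ x.2.card ≤ 2 * n * s ^ n := by
      refine le_trans (le_of_eq ?_) h1
      rw [Finset.sum_filter, Finset.sum_filter, ← (Equiv.prodComm _ _).sum_comp]
      simp [add_comm]
    -- the smaller one of the two sets determines the bound
    have h3 : ∀ S T : Finset (Fin n), S.card + T.card = n + 1 → S.card ≤ T.card →
        (s ^ 2) ^ (S.card * T.card) ≤ (s ^ n) ^ S.card := fun S T hST hle => by
      rw [← pow_mul, ← pow_mul]
      refine pow_le_pow_of_le_one hs0 hs1 ?_
      calc n * S.card ≤ (2 * T.card) * S.card := Nat.mul_le_mul_right _ (by omega)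
        _ = _ := by ring
    calc _ ≤ ∑ x : Finset (Fin n) × Finset (Fin n) with x.1.card + x.2.card = n + 1,
          ((s ^ n) ^ x.1.card + (s ^ n) ^ x.2.card) := by
          refine Finset.sum_le_sum fun x hx => ?_
          have hx := (Finset.mem_filter.1 hx).2
          rw [hcard]
          rcases le_total x.1.card x.2.card with hle | hle
          · exact (h3 _ _ hx hle).trans (le_add_of_nonneg_right (pow_nonneg hu _))
          · rw [mul_comm]
            exact (h3 _ _ (by omega) hle).trans (le_add_of_nonneg_left (pow_nonneg hu _))
      _ ≤ 4 * n * s ^ n := by rw [Finset.sum_add_distrib]; linarith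
  · intro G _ h
    refine hasMatchingEquiv_of_hall G fun S T hST => ?_
    obtain ⟨a, ha, b, hb, hab⟩ := exists_adj_of_mem_crossing
      (h (S, T) (Finset.mem_filter.2 ⟨Finset.mem_univ _, hST⟩))
    obtain ⟨a, ha', rfl⟩ := Finset.mem_map.1 ha
    obtain ⟨b, hb', rfl⟩ := Finset.mem_map.1 hb
    exact ⟨a, ha', b, hb', hab⟩

end Obstructions

/-! ### Answers for bipartite graphs with a perfect matching -/

section Answers

variable {n : ℕ} {G : SimpleGraph (Fin n ⊕ Fin n)}

theorem HasMatchingEquiv.exists_isPerfectMatching (h : HasMatchingEquiv n G) :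
    ∃ M : G.Subgraph, M.IsPerfectMatching ∧ n ≤ M.edgeSet.ncard := by
  obtain ⟨f, hf⟩ := h
  let M : G.Subgraph :=
    { verts := Set.univ
      Adj := fun x y => ∃ a, x = .inl a ∧ y = .inr (f a) ∨ y = .inl a ∧ x = .inr (f a)
      adj_sub := by
        rintro x y ⟨a, ⟨rfl, rfl⟩ | ⟨rfl, rfl⟩⟩
        exacts [hf a, (hf a).symm]
      edge_vert := fun _ => Set.mem_univ _
      symm := ⟨fun x y ⟨a, h⟩ => ⟨a, h.symm⟩⟩ }
  refine ⟨M, SimpleGraph.Subgraph.isPerfectMatching_iff.2 ?_, ?_⟩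
  · rintro (a | b)
    · refine ⟨.inr (f a), ⟨a, Or.inl ⟨rfl, rfl⟩⟩, ?_⟩
      rintro y ⟨a', ⟨h, rfl⟩ | ⟨-, h⟩⟩
      · rw [Sum.inl.inj h]
      · cases h
    · refine ⟨.inl (f.symm b), ⟨f.symm b, Or.inr ⟨rfl, by simp⟩⟩, ?_⟩
      rintro y ⟨a', ⟨h, -⟩ | ⟨rfl, h⟩⟩
      · cases h
      · rw [Sum.inr.inj h, Equiv.symm_apply_apply]
  · have hinj : Function.Injective
        fun a : Fin n => (s(.inl a, .inr (f a)) : Sym2 (Fin n ⊕ Fin n)) := by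
      intro a a' h
      simpa using h
    have hsub : Set.range (fun a : Fin n => (s(.inl a, .inr (f a)) : Sym2 (Fin n ⊕ Fin n))) ⊆
        M.edgeSet := by
      rintro _ ⟨a, rfl⟩
      exact ⟨a, Or.inl ⟨rfl, rfl⟩⟩
    calc n = (Set.range
            fun a : Fin n => (s(.inl a, .inr (f a)) : Sym2 (Fin n ⊕ Fin n))).ncard := by
          rw [← Set.image_univ, Set.ncard_image_of_injective _ hinj, Set.ncard_univ,
            Nat.card_eq_fintype_card, Fintype.card_fin]
      _ ≤ _ := Set.ncard_le_ncard hsub (Set.toFinite _)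

theorem ncard_edgeSet_le_of_isMatching (hG : G ≤ completeBipartiteGraph (Fin n) (Fin n))
    (M : G.Subgraph) (hM : M.IsMatching) : M.edgeSet.ncard ≤ n := by
  have hex : ∀ d ∈ M.edgeSet, ∃ a b, d = s(.inl a, .inr b) ∧ M.Adj (.inl a) (.inr b) := by
    intro d hd
    induction d with | _ x y => ?_
    have hadj : M.Adj x y := hd
    have := hG (M.adj_sub hadj)
    rcases x with x | x <;> rcases y with y | y <;> simp at this
    · exact ⟨x, y, rfl, hadj⟩
    · exact ⟨y, x, Sym2.eq_swap, hadj.symm⟩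
  choose a b hd hadj using fun d : M.edgeSet => hex d d.2
  have hinj : Function.Injective a := fun d d' heq => by
    have h := hadj d
    rw [heq] at h
    exact Subtype.ext (by rw [hd d, hd d', heq, hM.eq_of_adj_left h (hadj d')])
  simpa using Nat.card_le_card_of_injective a hinj

theorem HasMatchingEquiv.isGreatest (h : HasMatchingEquiv n G)
    (hG : G ≤ completeBipartiteGraph (Fin n) (Fin n)) :
    IsGreatest {m : ℕ | ∃ M : G.Subgraph, M.IsMatching ∧ M.edgeSet.ncard = m} n := by
  obtain ⟨M, hM, hn⟩ := h.exists_isPerfectMatching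
  refine ⟨⟨M, hM.1, (ncard_edgeSet_le_of_isMatching hG M hM.1).antisymm hn⟩, ?_⟩
  rintro m ⟨M', hM', rfl⟩
  exact ncard_edgeSet_le_of_isMatching hG M' hM'

theorem HasMatchingEquiv.vertexCoverNum_eq (h : HasMatchingEquiv n G)
    (hG : G ≤ completeBipartiteGraph (Fin n) (Fin n)) : G.vertexCoverNum = (n : ℕ∞) := by
  obtain ⟨f, hf⟩ := h
  refine le_antisymm ?_ ?_
  · have hc : G.IsVertexCover (Set.range Sum.inl) := by
      intro x y hxy
      have := hG hxy
      rcases x with x | x <;> rcases y with y | y <;> simp at this ⊢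
    refine hc.vertexCoverNum_le.trans_eq ?_
    rw [← Set.image_univ, Sum.inl_injective.encard_image, Set.encard_univ,
      ENat.card_eq_coe_fintype_card, Fintype.card_fin]
  · obtain ⟨c, hc, hcover⟩ := G.vertexCoverNum_exists
    rw [← hc]
    -- every edge of the matching contributes a node of its own to the cover
    have hex : ∀ a, ∃ x ∈ c, x = .inl a ∨ x = .inr (f a) := fun a => by
      rcases hcover (hf a) with h | h
      exacts [⟨_, h, Or.inl rfl⟩, ⟨_, h, Or.inr rfl⟩]
    choose g hgc hg using hex
    have hinj : Function.Injective g := by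
      intro a a' h
      rcases hg a with h1 | h1 <;> rcases hg a' with h2 | h2 <;> rw [h1, h2] at h
      · exact Sum.inl.inj h
      · cases h
      · cases h
      · exact f.injective (Sum.inr.inj h)
    calc (n : ℕ∞) = (Set.range g).encard := by
          rw [← Set.image_univ, hinj.encard_image, Set.encard_univ,
            ENat.card_eq_coe_fintype_card, Fintype.card_fin]
      _ ≤ c.encard := Set.encard_le_encard (by rintro _ ⟨a, rfl⟩; exact hgc a)

end Answers

/-! ### The trivial algorithm is correct -/

/-- A problem is solved by the trivial algorithm as soon as its constant answer can be preset, fits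
into the words and is correct whenever a property with few obstructions holds. -/
theorem constAlg_correct {i : Instr} {a : ℕ → ℕ} (hi : Presets i a) (Q : DynProblem)
    (ha : ∀ n w, 1 ≤ n → Q.numNodes n < 2 ^ w → a n < 2 ^ w)
    (hQ : ∀ n, 4 ≤ n → HasObstructions n (Q.allowed n) fun G =>
      Q.IsAnswer n G (a n)) :
    ∃ (A : DynAlg) (c : ℕ), A.AlwaysAnswers Q a ∧ A.RunsInTime Q c ∧
      ∀ (n w : ℕ), 1 ≤ n → Q.numNodes n < 2 ^ w →
      ∀ p : unitInterval, (p : ℝ) < 1 - 26 * Real.log n / n →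
      ∀ T : ℕ, (T : ℝ) ≤ (2 : ℝ) ^ ((n : ℝ) / 3) →
      ∀ H₀ ≤ Q.allowed n, ∀ e : Fin T → (Q.allowed n).edgeSet,
        1 - 1 / (n : ℝ) ≤ ((smoothedLaw p (Q.allowed n) H₀ e).toOuterMeasure
          {g | A.CorrectInAllRounds Q w g.1 g.2}).toReal := by
  refine ⟨constAlg i, 1, fun n w _ G₀ _ h => answer_constAlg hi Q n w G₀ h,
    runsInTime_constAlg hi Q, fun n w hn hw p hp T hT H₀ _ e => ?_⟩
  rcases hn.eq_or_lt with rfl | hn2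
  · simp
  have hn0 : (0 : ℝ) < n := by exact_mod_cast hn
  have hlog : 26 * Real.log n < n := by
    rw [← div_lt_one hn0]
    linarith [p.2.1]
  have hn108 := le_of_log_lt hn2 hlog
  refine ((hQ n (by omega)).le_smoothedLaw hn108 p hp hT H₀ e).trans ?_
  refine ENNReal.toReal_mono (ne_top_of_le_ne_top ENNReal.one_ne_top ?_)
    (MeasureTheory.measure_mono fun g hg =>
      correctInAllRounds_constAlg hi Q (ha n w hn hw) g.1 g.2 hg)
  rw [← (PMF.toOuterMeasure_apply_eq_one_iff _ _).2 (Set.subset_univ _)]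
  exact MeasureTheory.measure_mono (Set.subset_univ _)

end SmoothedDynamic

theorem mainTheorem6 (Q : SmoothedDynamic.DynProblem) (a : ℕ → ℕ)
    (hQ : (Q = SmoothedDynamic.connectivity ∧ a = fun _ => 1) ∨
      (Q = SmoothedDynamic.bipartitePerfectMatching ∧ a = fun _ => 1) ∨
      (Q = SmoothedDynamic.bipartiteMaximumMatching ∧ a = fun n => n) ∨
      (Q = SmoothedDynamic.bipartiteMinimumVertexCover ∧ a = fun n => n)) :
    ∃ (A : SmoothedDynamic.DynAlg) (c : ℕ),
      A.AlwaysAnswers Q a ∧ A.RunsInTime Q c ∧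
      ∀ (n w : ℕ), 1 ≤ n → Q.numNodes n < 2 ^ w →
      ∀ p : unitInterval, (p : ℝ) < 1 - 26 * Real.log n / n →
      ∀ T : ℕ, (T : ℝ) ≤ (2 : ℝ) ^ ((n : ℝ) / 3) →
      ∀ H₀ ≤ Q.allowed n, ∀ e : Fin T → (Q.allowed n).edgeSet,
        1 - 1 / (n : ℝ) ≤
          ((SmoothedDynamic.smoothedLaw p (Q.allowed n) H₀ e).toOuterMeasure
            {g | A.CorrectInAllRounds Q w g.1 g.2}).toReal := by
  rcases hQ with ⟨rfl, rfl⟩ | ⟨rfl, rfl⟩ | ⟨rfl, rfl⟩ | ⟨rfl, rfl⟩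
  · exact SmoothedDynamic.constAlg_correct (SmoothedDynamic.presets_const 1) _
      (fun n w hn hw => hn.trans_lt hw)
      fun n hn => (SmoothedDynamic.hasObstructions_connected hn).mono fun G _ h => Or.inl ⟨h, rfl⟩
  · exact SmoothedDynamic.constAlg_correct (SmoothedDynamic.presets_const 1) _
      (fun n w hn hw => hn.trans_lt ((Nat.le_add_left n n).trans_lt hw))
      fun n hn => (SmoothedDynamic.hasObstructions_hasMatchingEquiv hn).mono fun G _ h =>
        Or.inl ⟨h.exists_isPerfectMatching.imp fun _ hM => hM.1, rfl⟩
  · exact SmoothedDynamic.constAlg_correct SmoothedDynamic.presets_move _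
      (fun n w _ hw => (Nat.le_add_left n n).trans_lt hw)
      fun n hn => (SmoothedDynamic.hasObstructions_hasMatchingEquiv hn).mono
        fun G hG h => h.isGreatest hG
  · exact SmoothedDynamic.constAlg_correct SmoothedDynamic.presets_move _
      (fun n w _ hw => (Nat.le_add_left n n).trans_lt hw)
      fun n hn => (SmoothedDynamic.hasObstructions_hasMatchingEquiv hn).mono
        fun G hG h => h.vertexCoverNum_eq hG
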